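/- Theorem 2.3. Let $U$ be a reflexive and separable (real) Banach space, $m\ge 1$, and let $\xi$ be an $m$-dimensional random vector on a probability space $(\Omega,\mathcal F,\mathbb P)$ with centered Gaussian distribution $\mathcal N(0,\Sigma)$. Let $\Sigma^{1/2}$ be a root of $\Sigma$, i.e. an $m\times m$ matrix with $\Sigma^{1/2}(\Sigma^{1/2})^{\top}=\Sigma$. Let $g\colon U\times\mathbb R^m\to\mathbb R$ be locally Lipschitzian and jointly convex in both variables, and let $\bar u\in U$ be such that $g(\bar u,0)<0$ and the set $M=\{z\in\mathbb R^m\mid g(\bar u,z)\le 0\}$ is bounded. Let $$\varphi(u):=\mathbb P(g(u,\xi)\le 0),\qquad e(u,v):=\mu_\eta\{r\ge 0\mid g(u,r\Sigma^{1/2}v)\le 0\}\qquad(u\in U,\ v\in\mathbb S^{m-1}),$$ where $\mu_\eta$ is the one-dimensional chi distribution with $m$ degrees of freedom and $\mathbb S^{m-1}$ is the Euclidean unit sphere of $\mathbb R^m$, and let $\mu_\zeta$ be the uniform distribution on $\mathbb S^{m-1}$. Then $\varphi$ and all functions $e(\cdot,v)$, $v\in\mathbb S^{m-1}$, are Lipschitzian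 on a common neighborhood of $\bar u$ with a common constant, and $$\partial^C\varphi(\bar u)=\int_{\mathbb S^{m-1}}\partial^C_u e(\bar u,v)\,d\mu_\zeta(v).$$ Here, for a function $f\colon U\to\mathbb R$ that is Lipschitzian near $\bar u$, $\partial^C f(\bar u)=\{x^*\in U^*\mid x^*(h)\le f^0(\bar u;h)\ \forall h\in U\}$ is the Clarke subdifferential, with $f^0(\bar u;h)=\limsup_{u'\to\bar u,\,t\downarrow 0}\frac{f(u'+th)-f(u')}{t}$, and $\partial^C_u e(\bar u,v)$ is the Clarke subdifferential of $e(\cdot,v)$ at $\bar u$. The integral is understood in the sense of Aumann: it is the set of all $x^*\in U^*$ for which there is a measurable selection $x^*_v\in\partial^C_u e(\bar u,v)$ (for $\mu_\zeta$-a.e. $v$), meaning that $v\mapsto x^*_v(h)$ is measurable and integrable for every $h\in U$, such that $x^*(h)=\int_{\mathbb S^{m-1}}x^*_v(h)\,d\mu_\zeta(v)$ for all $h\in U$. -/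

import Mathlib

open MeasureTheory ProbabilityTheory Filter Topology

noncomputable section

/-- The Clarke directional derivative
`f°(x; h) = limsup_{x' → x, t ↓ 0} (f (x' + t h) - f x') / t`.
The upper limit is taken in the extended reals, so that no boundedness is needed to make sense of
it; it is finite as soon as `f` is Lipschitz near `x`. -/
def clarkeDeriv {X : Type*} [NormedAddCommGroup X] [NormedSpace ℝ X]
    (f : X → ℝ) (x h : X) : EReal :=
  limsup (fun p : X × ℝ => (((f (p.1 + p.2 • h) - f p.1) / p.2 : ℝ) : EReal))
    (𝓝 x ×ˢ 𝓝[>] (0 : ℝ))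

/-- The Clarke subdifferential `∂ᶜf(x)`: all continuous linear functionals `x*` with
`⟨x*, h⟩ ≤ f°(x; h)` for every direction `h`. -/
def clarkeSubdifferential {X : Type*} [NormedAddCommGroup X] [NormedSpace ℝ X]
    (f : X → ℝ) (x : X) : Set (StrongDual ℝ X) :=
  {x' | ∀ h : X, ((x' h : ℝ) : EReal) ≤ clarkeDeriv f x h}

/-- The Aumann integral of a multifunction `S` with values in the subsets of a dual space: all
functionals `x*` for which there is a measurable selection `s` of `S` (almost everywhere) such that
`x*(h) = ∫ s_t(h) dμ(t)` for every `h`. -/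
def aumannIntegral {T : Type*} [MeasurableSpace T] {X : Type*} [NormedAddCommGroup X]
    [NormedSpace ℝ X] (μ : Measure T) (S : T → Set (StrongDual ℝ X)) : Set (StrongDual ℝ X) :=
  {x' | ∃ s : T → StrongDual ℝ X,
    (∀ h : X, Measurable fun t => s t h) ∧
    (∀ᵐ t ∂μ, s t ∈ S t) ∧
    (∀ h : X, Integrable (fun t => s t h) μ ∧ x' h = ∫ t, s t h ∂μ)}

/-- The unit sphere of the Euclidean space `ℝᵐ`. -/
abbrev UnitSphere (m : ℕ) : Type :=
  Metric.sphere (0 : EuclideanSpace ℝ (Fin m)) 1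

/-- The uniform distribution on the unit sphere of `ℝᵐ`: normalized surface measure. -/
def uniformSphere (m : ℕ) : Measure (UnitSphere m) :=
  ((volume : Measure (EuclideanSpace ℝ (Fin m))).toSphere Set.univ)⁻¹ •
    (volume : Measure (EuclideanSpace ℝ (Fin m))).toSphere

/-- The density `2 ^ (1 - m / 2) / Γ(m / 2) * r ^ (m - 1) * exp (- r ^ 2 / 2)` on `(0, ∞)` of the
chi distribution with `m` degrees of freedom. -/
def chiDensity (m : ℕ) (r : ℝ) : ℝ :=
  (2 : ℝ) ^ (1 - (m : ℝ) / 2) / Real.Gamma ((m : ℝ) / 2) * r ^ (m - 1) * Real.exp (-r ^ 2 / 2)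

/-- The one-dimensional chi distribution with `m ≥ 1` degrees of freedom. -/
def chiMeasure (m : ℕ) : Measure ℝ :=
  ((volume : Measure ℝ).restrict (Set.Ioi 0)).withDensity fun r => ENNReal.ofReal (chiDensity m r)

/-- The probability function `φ(u) = P(g(u, ξ) ≤ 0)`. -/
def probFun {U Ω : Type*} [MeasurableSpace Ω] {m : ℕ} (P : Measure Ω)
    (ξ : Ω → EuclideanSpace ℝ (Fin m)) (g : U → EuclideanSpace ℝ (Fin m) → ℝ) (u : U) : ℝ :=
  P.real {ω | g u (ξ ω) ≤ 0}

/-- The radial probability function `e(u, v) = μ_η {r ≥ 0 | g(u, r A v) ≤ 0}`, where `A` is a root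
of the covariance matrix and `μ_η` is the chi distribution with `m` degrees of freedom. -/
def radialProbFun {U : Type*} {m : ℕ} (A : Matrix (Fin m) (Fin m) ℝ)
    (g : U → EuclideanSpace ℝ (Fin m) → ℝ) (u : U) (v : UnitSphere m) : ℝ :=
  (chiMeasure m).real
    {r : ℝ | 0 ≤ r ∧
      g u (r • Matrix.toEuclideanCLM (𝕜 := ℝ) A (v : EuclideanSpace ℝ (Fin m))) ≤ 0}

end

open MeasureTheory ProbabilityTheory Filter Topology

/-! Polar coordinates turn the probability function into the average over the sphere of the radial
functions `e(·, v)`. The question is then when the Clarke subdifferential commutes with an integral.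
In general only an inclusion holds. Equality holds here because each `e(·, v)` is regular "from the
left": at `u₀` the quotients `(f x - f (x - s • h)) / s` converge, and their limit `p` also bounds
every Clarke quotient asymptotically, so `f°(x; h) = p`. This property (`HasRegularUpperDeriv`)
survives integration by dominated convergence, so the Clarke derivative of the integral is the
integral of the Clarke derivatives.

Regularity comes from convexity. Where `A v ≠ 0`, boundedness of `M` makes the largest admissible
radius `ρ(u)` finite near `u₀`, joint convexity of `g` makes it concave, and `e(·, v)` is the
increasing C¹ chi distribution function composed with `ρ`. Where `A v = 0`, `e(·, v)` is locally
constant.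

The common Lipschitz constant cannot come from `ρ`, which has no bound uniform in `v`. It comes from
a scaling estimate: shrinking a set of radii by `c ≤ 1` costs at most a factor `c ^ m` of chi
measure.

Passing from support functions to sets is Strassen's disintegration theorem: Hahn–Banach on an L²
space, Riesz representation in each direction, and gluing over a countable dense subgroup. -/

/-! ### Spheric-radial decomposition of Gaussian measures. -/

open scoped RealInnerProductSpace in
theorem stdGaussian_eq_withDensity (m : ℕ) :
    stdGaussian (EuclideanSpace ℝ (Fin m)) =
      (volume : Measure (EuclideanSpace ℝ (Fin m))).withDensity fun x =>
        ENNReal.ofReal ((2 * Real.pi) ^ (-(m : ℝ) / 2) * Real.exp (-‖x‖ ^ 2 / 2)) := by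
  have hmeas : Measurable fun x : EuclideanSpace ℝ (Fin m) =>
      ENNReal.ofReal ((2 * Real.pi) ^ (-(m : ℝ) / 2) * Real.exp (-‖x‖ ^ 2 / 2)) := by fun_prop
  have hint : Integrable fun x : EuclideanSpace ℝ (Fin m) =>
      (2 * Real.pi) ^ (-(m : ℝ) / 2) * Real.exp (-‖x‖ ^ 2 / 2) := by
    refine Integrable.const_mul ?_ _
    have := (GaussianFourier.integrable_cexp_neg_mul_sq_norm_add (b := 1 / 2)
      (V := EuclideanSpace ℝ (Fin m)) (by norm_num) 0 0).norm
    refine this.congr (Eventually.of_forall fun x => ?_)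
    simp only [Complex.norm_exp]
    congr 1
    simp [← Complex.ofReal_pow]
    ring
  have : IsFiniteMeasure ((volume : Measure (EuclideanSpace ℝ (Fin m))).withDensity fun x =>
        ENNReal.ofReal ((2 * Real.pi) ^ (-(m : ℝ) / 2) * Real.exp (-‖x‖ ^ 2 / 2))) :=
    isFiniteMeasure_withDensity_ofReal hint.2
  refine Measure.ext_of_charFun (funext fun t => ?_)
  rw [charFun_stdGaussian, charFun_apply,
    integral_withDensity_eq_integral_toReal_smul hmeas (by simp)]
  have h1 : ∀ x : EuclideanSpace ℝ (Fin m),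
      (ENNReal.ofReal ((2 * Real.pi) ^ (-(m : ℝ) / 2) * Real.exp (-‖x‖ ^ 2 / 2))).toReal •
        Complex.exp (⟪x, t⟫ * Complex.I) =
      (((2 * Real.pi) ^ (-(m : ℝ) / 2) : ℝ) : ℂ) *
        Complex.exp (-(1 / 2 : ℂ) * ‖x‖ ^ 2 + Complex.I * ⟪t, x⟫) := by
    intro x
    rw [ENNReal.toReal_ofReal (by positivity), Complex.exp_add, real_inner_comm, Complex.real_smul]
    push_cast
    rw [mul_assoc]
    congr 3
    · ring
    · rw [mul_comm]
  simp_rw [h1]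
  rw [integral_const_mul, GaussianFourier.integral_cexp_neg_mul_sq_norm_add (by norm_num)]
  rw [finrank_euclideanSpace_fin, ← mul_assoc]
  have h2 : ((Real.pi : ℂ) / (1 / 2)) ^ ((m : ℂ) / 2) =
      (((2 * Real.pi) ^ ((m : ℝ) / 2) : ℝ) : ℂ) := by
    rw [Complex.ofReal_cpow (by positivity)]
    push_cast
    congr 1
    ring
  rw [h2, ← Complex.ofReal_mul, ← Real.rpow_add (by positivity)]
  simp only [neg_div, neg_add_cancel, Real.rpow_zero, Complex.ofReal_one, one_mul]
  congr 1
  simp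
  ring

/-- The characteristic function of the image sees `A` only through `‖Aᵀ t‖² = t · A Aᵀ t`, so any
root of the covariance serves, symmetric or not. -/
theorem multivariateGaussian_mul_transpose {m : ℕ} (A : Matrix (Fin m) (Fin m) ℝ) :
    multivariateGaussian 0 (A * A.transpose) =
      (stdGaussian (EuclideanSpace ℝ (Fin m))).map (Matrix.toEuclideanCLM (𝕜 := ℝ) A) := by
  have hpos : (A * A.transpose).PosSemidef := by
    simpa using Matrix.posSemidef_self_mul_conjTranspose A
  refine Measure.ext_of_charFun (funext fun t => ?_)
  set L := Matrix.toEuclideanCLM (𝕜 := ℝ) A with hL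
  have hadj : ‖ContinuousLinearMap.adjoint L t‖ ^ 2 = t ⬝ᵥ (A * A.transpose).mulVec t := by
    rw [← real_inner_self_eq_norm_sq, ContinuousLinearMap.adjoint_inner_left,
      ← ContinuousLinearMap.star_eq_adjoint, hL, ← map_star, ← mul_apply_eq_comp,
      ← map_mul, Matrix.inner_toEuclideanCLM, Matrix.star_eq_conjTranspose,
      Matrix.conjTranspose_eq_transpose_of_trivial]
  have hmap : charFun ((stdGaussian (EuclideanSpace ℝ (Fin m))).map L) t =
      charFun (stdGaussian (EuclideanSpace ℝ (Fin m))) (ContinuousLinearMap.adjoint L t) := by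
    rw [charFun_apply, charFun_apply, integral_map (by fun_prop) (by fun_prop)]
    simp only [ContinuousLinearMap.adjoint_inner_right]
  rw [charFun_multivariateGaussian hpos, hmap, charFun_stdGaussian, ← Complex.ofReal_pow, hadj]
  simp [neg_div]

theorem lintegral_eq_lintegral_toSphere {m : ℕ} (hm : 0 < m)
    (f : EuclideanSpace ℝ (Fin m) → ENNReal) (hf : Measurable f) :
    ∫⁻ x, f x = ∫⁻ v : UnitSphere m, (∫⁻ r in Set.Ioi (0 : ℝ), ENNReal.ofReal (r ^ (m - 1)) *
      f (r • (v : EuclideanSpace ℝ (Fin m))))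
        ∂(volume : Measure (EuclideanSpace ℝ (Fin m))).toSphere := by
  have : Nonempty (Fin m) := ⟨⟨0, hm⟩⟩
  have hg : ∀ v : UnitSphere m, Measurable fun r : ℝ =>
      f (r • (v : EuclideanSpace ℝ (Fin m))) := fun v => hf.comp (by fun_prop)
  calc ∫⁻ x, f x = ∫⁻ x in ({0}ᶜ : Set (EuclideanSpace ℝ (Fin m))), f x := by simp
    _ = ∫⁻ x : ({0}ᶜ : Set (EuclideanSpace ℝ (Fin m))), f x ∂(volume.comap Subtype.val) := by
      rw [lintegral_subtype_comap (measurableSet_singleton _).compl]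
    _ = ∫⁻ p : UnitSphere m × Set.Ioi (0 : ℝ), f ((p.2 : ℝ) • (p.1 : EuclideanSpace ℝ (Fin m)))
        ∂((volume : Measure (EuclideanSpace ℝ (Fin m))).toSphere.prod
          (Measure.volumeIoiPow (m - 1))) := by
      have h := (volume : Measure
        (EuclideanSpace ℝ (Fin m))).measurePreserving_homeomorphUnitSphereProd
      rw [finrank_euclideanSpace_fin] at h
      rw [← h.lintegral_comp_emb (Homeomorph.measurableEmbedding _)]
      refine lintegral_congr fun x => ?_
      congr 1
      have hx : ‖(x : EuclideanSpace ℝ (Fin m))‖ ≠ 0 := norm_ne_zero_iff.2 x.2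
      simp [smul_smul, hx]
    _ = _ := by
      rw [lintegral_prod _ (by fun_prop)]
      refine lintegral_congr fun v => ?_
      rw [Measure.volumeIoiPow]
      refine (lintegral_withDensity_eq_lintegral_mul _ (by fun_prop)
        ((hg v).comp measurable_subtype_coe)).trans ?_
      exact lintegral_subtype_comap measurableSet_Ioi
        (fun r : ℝ => ENNReal.ofReal (r ^ (m - 1)) * f (r • (v : EuclideanSpace ℝ (Fin m))))

/-- Matches the normalizing constants: the sphere has area `2 π^(m/2) / Γ(m/2)`. -/
theorem toSphere_univ_mul_gaussianConst {m : ℕ} (hm : 0 < m) :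
    (volume : Measure (EuclideanSpace ℝ (Fin m))).toSphere Set.univ *
      ENNReal.ofReal ((2 * Real.pi) ^ (-(m : ℝ) / 2)) =
    ENNReal.ofReal ((2 : ℝ) ^ (1 - (m : ℝ) / 2) / Real.Gamma ((m : ℝ) / 2)) := by
  have : Nonempty (Fin m) := ⟨⟨0, hm⟩⟩
  have hm' : (0 : ℝ) < m / 2 := by positivity
  have hG := Real.Gamma_pos_of_pos hm'
  rw [Measure.toSphere_apply_univ, EuclideanSpace.volume_ball, finrank_euclideanSpace_fin,
    ← ENNReal.ofReal_natCast]
  simp only [Fintype.card_fin, ENNReal.ofReal_one, one_pow, one_mul]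
  rw [← ENNReal.ofReal_mul (by positivity), ← ENNReal.ofReal_mul (by positivity)]
  congr 1
  rw [Real.Gamma_add_one hm'.ne', Real.mul_rpow (by norm_num) Real.pi_pos.le, neg_div,
    Real.rpow_neg Real.pi_pos.le, Real.rpow_sub two_pos, Real.rpow_one, Real.rpow_neg two_pos.le,
    Real.sqrt_eq_rpow, ← Real.rpow_mul_natCast Real.pi_pos.le]
  have : (1 / 2 : ℝ) * m = m / 2 := by ring
  rw [this]
  have := Real.rpow_pos_of_pos Real.pi_pos ((m : ℝ) / 2)
  field_simp

theorem measurable_chiDensity (m : ℕ) : Measurable (chiDensity m) := by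
  unfold chiDensity
  fun_prop

theorem chiMeasure_apply (m : ℕ) {S : Set ℝ} (hS : MeasurableSet S) :
    chiMeasure m S = ∫⁻ r in Set.Ioi (0 : ℝ), S.indicator 1 r * ENNReal.ofReal (chiDensity m r) := by
  rw [chiMeasure, withDensity_apply _ hS, ← lintegral_indicator hS]
  refine lintegral_congr fun r => ?_
  by_cases h : r ∈ S <;> simp [h]

theorem stdGaussian_eq_lintegral_chiMeasure {m : ℕ} (hm : 0 < m)
    {S : Set (EuclideanSpace ℝ (Fin m))} (hS : MeasurableSet S) :
    stdGaussian (EuclideanSpace ℝ (Fin m)) S =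
      ∫⁻ v, chiMeasure m {r : ℝ | 0 ≤ r ∧ r • (v : EuclideanSpace ℝ (Fin m)) ∈ S}
        ∂(uniformSphere m) := by
  have : Nonempty (Fin m) := ⟨⟨0, hm⟩⟩
  have h0 : (volume : Measure (EuclideanSpace ℝ (Fin m))).toSphere Set.univ ≠ 0 :=
    Measure.measure_univ_ne_zero.2 (Measure.toSphere_ne_zero _)
  have h1 : (volume : Measure (EuclideanSpace ℝ (Fin m))).toSphere Set.univ ≠ ⊤ :=
    measure_ne_top _ _
  rw [stdGaussian_eq_withDensity, withDensity_apply _ hS, ← lintegral_indicator hS,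
    lintegral_eq_lintegral_toSphere hm _ ((by fun_prop : Measurable _).indicator hS),
    uniformSphere, lintegral_smul_measure, smul_eq_mul, ← lintegral_const_mul' _ _ (ENNReal.inv_ne_top.2 h0)]
  refine lintegral_congr fun v => ?_
  have hSv : MeasurableSet {r : ℝ | 0 ≤ r ∧ r • (v : EuclideanSpace ℝ (Fin m)) ∈ S} :=
    measurableSet_Ici.inter (hS.preimage (by fun_prop))
  rw [chiMeasure_apply m hSv, ← lintegral_const_mul' _ _ (ENNReal.inv_ne_top.2 h0)]
  refine setLIntegral_congr_fun measurableSet_Ioi fun r hr => ?_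
  have hr' : (0 : ℝ) < r := hr
  by_cases h : r • (v : EuclideanSpace ℝ (Fin m)) ∈ S
  · simp only [h, Set.indicator_of_mem, Set.mem_ofPred_eq, hr'.le, and_self, Pi.one_apply, one_mul,
      norm_smul, norm_eq_of_mem_sphere v, mul_one, Real.norm_eq_abs, sq_abs]
    rw [ENNReal.ofReal_mul (by positivity), chiDensity, mul_assoc, ENNReal.ofReal_mul,
      ← toSphere_univ_mul_gaussianConst hm, ENNReal.ofReal_mul (by positivity)]
    · rw [mul_assoc, ← mul_assoc (_)⁻¹, ENNReal.inv_mul_cancel h0 h1, one_mul]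
      ring
    · have := Real.Gamma_pos_of_pos (by positivity : (0 : ℝ) < m / 2)
      positivity
  · simp [h]

theorem isProbabilityMeasure_uniformSphere {m : ℕ} (hm : 0 < m) :
    IsProbabilityMeasure (uniformSphere m) := by
  have : Nonempty (Fin m) := ⟨⟨0, hm⟩⟩
  have h0 : (volume : Measure (EuclideanSpace ℝ (Fin m))).toSphere Set.univ ≠ 0 :=
    Measure.measure_univ_ne_zero.2 (Measure.toSphere_ne_zero _)
  have h1 : (volume : Measure (EuclideanSpace ℝ (Fin m))).toSphere Set.univ ≠ ⊤ := measure_ne_top _ _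
  refine ⟨?_⟩
  rw [uniformSphere, Measure.smul_apply, smul_eq_mul, ENNReal.inv_mul_cancel h0 h1]

/-- Total mass one is read off the decomposition of the whole space, with no Gamma integral to
compute. -/
theorem isProbabilityMeasure_chiMeasure {m : ℕ} (hm : 0 < m) :
    IsProbabilityMeasure (chiMeasure m) := by
  have := isProbabilityMeasure_uniformSphere hm
  have h := stdGaussian_eq_lintegral_chiMeasure hm MeasurableSet.univ
  simp only [measure_univ, Set.mem_univ, and_true, lintegral_const, mul_one] at h
  refine ⟨?_⟩
  change 1 = chiMeasure m (Set.Ici 0) at h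
  rw [h, chiMeasure_apply m MeasurableSet.univ, chiMeasure_apply m measurableSet_Ici]
  refine setLIntegral_congr_fun measurableSet_Ioi fun r (hr : 0 < r) => ?_
  simp [hr.le]

/-! ### Regular upper derivatives and differentiation under the integral. -/

/-- `f` has regular upper derivative `p` at `x` in direction `h`: the left difference quotients of
`f` at `x` converge to `p`, and `p` is an upper bound for the Clarke directional derivative. -/
structure HasRegularUpperDeriv {X : Type*} [NormedAddCommGroup X] [NormedSpace ℝ X]
    (f : X → ℝ) (x h : X) (p : ℝ) : Prop where
  tendsto : Tendsto (fun s : ℝ => (f x - f (x - s • h)) / s) (𝓝[>] 0) (𝓝 p)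
  eventually_le : ∀ c > p, ∀ᶠ q : X × ℝ in 𝓝 x ×ˢ 𝓝[>] (0 : ℝ),
    (f (q.1 + q.2 • h) - f q.1) / q.2 ≤ c

section RegularUpperDeriv

variable {X : Type*} [NormedAddCommGroup X] [NormedSpace ℝ X] {f : X → ℝ} {x h k : X}
  {p q r : ℝ}

theorem tendsto_sub_smul_nhdsGT (x h : X) :
    Tendsto (fun s : ℝ => x - s • h) (𝓝[>] 0) (𝓝 x) := by
  have : Continuous fun s : ℝ => x - s • h := by fun_prop
  simpa using (this.tendsto 0).mono_left nhdsWithin_le_nhds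

theorem tendsto_add_smul_prod_nhdsGT (x h : X) :
    Tendsto (fun q : X × ℝ => q.1 + q.2 • h) (𝓝 x ×ˢ 𝓝[>] (0 : ℝ)) (𝓝 x) := by
  have : Continuous fun q : X × ℝ => q.1 + q.2 • h := by fun_prop
  have h0 := this.tendsto (x, 0)
  simp only [zero_smul, add_zero, nhds_prod_eq] at h0
  exact h0.mono_left (Filter.prod_mono le_rfl nhdsWithin_le_nhds)

theorem tendsto_sub_smul_prodMk (x h : X) :
    Tendsto (fun s : ℝ => (x - s • h, s)) (𝓝[>] 0) (𝓝 x ×ˢ 𝓝[>] (0 : ℝ)) :=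
  (tendsto_sub_smul_nhdsGT x h).prodMk tendsto_id

namespace HasRegularUpperDeriv

/-- The left quotients at `x` are Clarke quotients with moving base point `x - s • h`, so their
limit is also a lower bound for the limsup. -/
theorem clarkeDeriv_eq (hp : HasRegularUpperDeriv f x h p) : clarkeDeriv f x h = (p : EReal) := by
  refine le_antisymm ?_ ?_
  · refine EReal.le_of_forall_lt_iff_le.1 fun z hz => ?_
    refine limsup_le_of_le (by isBoundedDefault) ?_
    filter_upwards [hp.eventually_le z (by exact_mod_cast hz)] with q hq
    exact_mod_cast hq
  · have h1 : Tendsto (fun s : ℝ => (((f x - f (x - s • h)) / s : ℝ) : EReal)) (𝓝[>] 0)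
        (𝓝 (p : EReal)) := (continuous_coe_real_ereal.tendsto p).comp hp.tendsto
    rw [← h1.limsup_eq]
    have h2 := limsup_le_limsup_of_le (tendsto_sub_smul_prodMk x h)
      (u := fun p : X × ℝ => (((f (p.1 + p.2 • h) - f p.1) / p.2 : ℝ) : EReal))
    refine le_trans (le_of_eq ?_) h2
    simp only [limsup, Filter.map_map, Function.comp_def, sub_add_cancel]

theorem le_add (hh : HasRegularUpperDeriv f x h p) (hk : HasRegularUpperDeriv f x k q)
    (hhk : HasRegularUpperDeriv f x (h + k) r) : r ≤ p + q := by
  refine le_of_forall_pos_le_add fun ε hε => ?_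
  have h1 : Tendsto (fun s : ℝ => (x - s • (h + k), s)) (𝓝[>] 0) (𝓝 x ×ˢ 𝓝[>] (0 : ℝ)) :=
    tendsto_sub_smul_prodMk x (h + k)
  have h2 : Tendsto (fun s : ℝ => (f x - f (x - s • h)) / s + (q + ε)) (𝓝[>] 0)
      (𝓝 (p + (q + ε))) := hh.tendsto.add_const _
  rw [add_assoc]
  refine le_of_tendsto_of_tendsto hhk.tendsto h2 ?_
  -- The increment along `h + k` splits at `x - s • h`; its `k`-part starts at the moving point `x -
  -- s • (h + k)`, which the bound uniform in base points covers.
  filter_upwards [h1.eventually (hk.eventually_le (q + ε) (by linarith))] with s hs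
  have h3 : x - s • (h + k) + s • k = x - s • h := by rw [smul_add]; abel
  rw [h3] at hs
  have h4 : (f x - f (x - s • (h + k))) / s =
      (f x - f (x - s • h)) / s + (f (x - s • h) - f (x - s • (h + k))) / s := by ring
  linarith

theorem smul_eq {c : ℝ} (hc : 0 < c) (hh : HasRegularUpperDeriv f x h p)
    (hch : HasRegularUpperDeriv f x (c • h) q) : q = c * p := by
  have h1 : Tendsto (fun s : ℝ => s * c) (𝓝[>] 0) (𝓝[>] 0) := by
    refine tendsto_nhdsWithin_iff.2 ⟨?_, ?_⟩
    · have : Continuous fun s : ℝ => s * c := by fun_prop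
      simpa using (this.tendsto 0).mono_left nhdsWithin_le_nhds
    · filter_upwards [self_mem_nhdsWithin] with s hs
      exact mul_pos hs hc
  refine tendsto_nhds_unique hch.tendsto (((hh.tendsto.comp h1).const_mul c).congr' ?_)
  filter_upwards [self_mem_nhdsWithin] with s (hs : 0 < s)
  simp only [Function.comp_apply, smul_smul]
  field_simp

theorem abs_le {K : NNReal} {N : Set X} (hN : N ∈ 𝓝 x) (hf : LipschitzOnWith K f N)
    (hh : HasRegularUpperDeriv f x h p) : |p| ≤ K * ‖h‖ := by
  refine le_of_tendsto hh.tendsto.abs ?_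
  filter_upwards [tendsto_sub_smul_nhdsGT x h hN, self_mem_nhdsWithin] with s hs (hs0 : 0 < s)
  have := hf.dist_le_mul x (mem_of_mem_nhds hN) _ hs
  rw [Real.dist_eq, dist_eq_norm, sub_sub_cancel, norm_smul, Real.norm_eq_abs, abs_of_pos hs0]
    at this
  rw [abs_div, abs_of_pos hs0, div_le_iff₀ hs0]
  linarith

theorem congr {g : X → ℝ} (hfg : f =ᶠ[𝓝 x] g) (hp : HasRegularUpperDeriv f x h p) :
    HasRegularUpperDeriv g x h p := by
  refine ⟨hp.tendsto.congr' ?_, fun c hc => ?_⟩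
  · filter_upwards [(tendsto_sub_smul_nhdsGT x h).eventually hfg] with s hs
    rw [hs, hfg.self_of_nhds]
  · filter_upwards [hp.eventually_le c hc, (tendsto_add_smul_prod_nhdsGT x h).eventually hfg,
      tendsto_fst.eventually hfg] with q h1 h2 h3
    rwa [← h2, ← h3]

theorem const (c : ℝ) : HasRegularUpperDeriv (fun _ : X => c) x h 0 :=
  ⟨by simp, fun c hc => Eventually.of_forall fun _ => by simpa using hc.le⟩

/-- The derivative rule under the integral sign for regular upper derivatives. -/
theorem integral {T : Type*} [MeasurableSpace T] {μ : Measure T} [IsFiniteMeasure μ]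
    {F : X → T → ℝ} (hF : ∀ u, Integrable (F u) μ) {K : NNReal} {N : Set X} (hN : N ∈ 𝓝 x)
    (hLip : ∀ t, LipschitzOnWith K (fun u => F u t) N) {P : T → ℝ}
    (hP : ∀ t, HasRegularUpperDeriv (fun u => F u t) x h (P t)) :
    Integrable P μ ∧ HasRegularUpperDeriv (fun u => ∫ t, F u t ∂μ) x h (∫ t, P t ∂μ) := by
  have hquot : ∀ {a b : X} {s : ℝ}, a ∈ N → b ∈ N → 0 < s → a - b = s • h → ∀ t,
      |(F a t - F b t) / s| ≤ K * ‖h‖ := by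
    intro a b s ha hb hs hab t
    have := (hLip t).dist_le_mul a ha b hb
    rw [Real.dist_eq, dist_eq_norm, hab, norm_smul, Real.norm_eq_abs, abs_of_pos hs] at this
    rw [abs_div, abs_of_pos hs, div_le_iff₀ hs]
    linarith
  have hint : ∀ (a b : X) (s : ℝ), Integrable (fun t => (F a t - F b t) / s) μ := fun a b s =>
    ((hF a).sub (hF b)).div_const s
  have hPmeas : AEStronglyMeasurable P μ :=
    aestronglyMeasurable_of_tendsto_ae (𝓝[>] (0 : ℝ)) (fun s => (hint x (x - s • h) s).1)
      (Eventually.of_forall fun t => (hP t).tendsto)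
  have hPint : Integrable P μ := Integrable.of_bound hPmeas (K * ‖h‖)
    (Eventually.of_forall fun t => (hP t).abs_le hN (hLip t))
  refine ⟨hPint, ?_, fun c hc => ?_⟩
  · have : ∀ s : ℝ, (∫ t, F x t ∂μ - ∫ t, F (x - s • h) t ∂μ) / s =
        ∫ t, (F x t - F (x - s • h) t) / s ∂μ := fun s => by
      rw [integral_div, integral_sub (hF _) (hF _)]
    simp_rw [this]
    refine tendsto_integral_filter_of_dominated_convergence (fun _ => K * ‖h‖)
      (Eventually.of_forall fun s => (hint _ _ _).1) ?_ (integrable_const _)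
      (Eventually.of_forall fun t => (hP t).tendsto)
    filter_upwards [tendsto_sub_smul_nhdsGT x h hN, self_mem_nhdsWithin] with s hs hs0
    exact Eventually.of_forall (hquot (mem_of_mem_nhds hN) hs hs0 (by abel))
  -- A reverse Fatou argument: quotients at moving base points need not converge, but their excess
  -- over `P t` tends to zero and is dominated.
  · have key : Tendsto (fun q : X × ℝ =>
        ∫ t, max ((F (q.1 + q.2 • h) t - F q.1 t) / q.2 - P t) 0 ∂μ)
        (𝓝 x ×ˢ 𝓝[>] (0 : ℝ)) (𝓝 (∫ _, (0 : ℝ) ∂μ)) := by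
      refine tendsto_integral_filter_of_dominated_convergence (fun _ => K * ‖h‖ + K * ‖h‖)
        (Eventually.of_forall fun q => (((hint _ _ _).sub hPint).pos_part).1) ?_
        (integrable_const _) (Eventually.of_forall fun t => ?_)
      · filter_upwards [tendsto_add_smul_prod_nhdsGT x h hN, tendsto_fst hN,
          tendsto_snd self_mem_nhdsWithin] with q h1 h2 (h3 : 0 < q.2)
        refine Eventually.of_forall fun t => ?_
        have h4 := hquot h1 h2 h3 (add_sub_cancel_left _ _) t
        have h5 := (hP t).abs_le hN (hLip t)
        rw [Real.norm_eq_abs, abs_of_nonneg (le_max_right _ _)]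
        rw [_root_.abs_le] at h4 h5
        refine max_le ?_ ?_ <;> linarith [h4.1, h4.2, h5.1, h5.2]
      · rw [tendsto_order]
        refine ⟨fun a ha => Eventually.of_forall fun q => lt_max_of_lt_right ha, fun a ha => ?_⟩
        filter_upwards [(hP t).eventually_le (P t + a / 2) (by linarith)] with q hq
        refine max_lt ?_ ha
        linarith
    rw [integral_zero] at key
    filter_upwards [key.eventually (gt_mem_nhds (sub_pos.2 hc))] with q hq
    have : (∫ t, F (q.1 + q.2 • h) t ∂μ - ∫ t, F q.1 t ∂μ) / q.2 =
        ∫ t, (F (q.1 + q.2 • h) t - F q.1 t) / q.2 ∂μ := by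
      rw [integral_div, integral_sub (hF _) (hF _)]
    rw [this]
    have h6 : ∫ t, (F (q.1 + q.2 • h) t - F q.1 t) / q.2 ∂μ - ∫ t, P t ∂μ ≤
        ∫ t, max ((F (q.1 + q.2 • h) t - F q.1 t) / q.2 - P t) 0 ∂μ := by
      rw [← integral_sub (hint _ _ _) hPint]
      exact integral_mono ((hint _ _ _).sub hPint) ((hint _ _ _).sub hPint).pos_part
        fun t => le_max_left _ _
    linarith

end HasRegularUpperDeriv

end RegularUpperDeriv

/-! ### Strassen's disintegration theorem. -/

/-- A bounded additive map extends by uniform continuity, and a continuous additive map is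
automatically `ℝ`-linear; hence a subgroup suffices and no scalar relations need be checked. -/
theorem exists_strongDual_eqOn_of_dense {U : Type*} [NormedAddCommGroup U] [NormedSpace ℝ U]
    (D : Submodule ℤ U) (hD : Dense (D : Set U)) (a : U → ℝ) {K : ℝ}
    (hadd : ∀ d ∈ D, ∀ e ∈ D, a (d + e) = a d + a e) (hbd : ∀ d ∈ D, |a d| ≤ K * ‖d‖) :
    ∃ s : StrongDual ℝ U, ∀ d ∈ D, s d = a d := by
  let φ₀ : D →+ ℝ := AddMonoidHom.mk' (fun d => a d) fun d e => hadd d d.2 e e.2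
  have hφ₀ : Continuous φ₀ := AddMonoidHomClass.continuous_of_bound φ₀ K fun d => hbd d d.2
  let φ : D →L[ℤ] ℝ := ⟨φ₀.toIntLinearMap, hφ₀⟩
  let e : D →L[ℤ] U := D.subtypeL
  have he : DenseRange e := by
    have : Set.range e = D := Subtype.range_coe
    rwa [DenseRange, this]
  have hi : IsUniformInducing e := isUniformInducing_val _
  let ψ : U →L[ℤ] ℝ := φ.extend e
  refine ⟨ψ.toLinearMap.toAddMonoidHom.toRealLinearMap ψ.continuous, fun d hd => ?_⟩
  exact ContinuousLinearMap.extend_eq φ he hi ⟨d, hd⟩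

theorem exists_countable_dense_submodule (U : Type*) [NormedAddCommGroup U]
    [TopologicalSpace.SeparableSpace U] :
    ∃ D : Submodule ℤ U, (D : Set U).Countable ∧ Dense (D : Set U) := by
  refine ⟨Submodule.span ℤ (Set.range (TopologicalSpace.denseSeq U)), ?_,
    (TopologicalSpace.denseRange_denseSeq U).mono Submodule.subset_span⟩
  rw [← Finsupp.range_linearCombination, LinearMap.coe_range]
  exact Set.countable_range _

section Disintegration

variable {T : Type*} [MeasurableSpace T] {μ : Measure T} {U : Type*} [NormedAddCommGroup U]
  {p : T → U → ℝ} {K : ℝ}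

theorem continuous_of_subadditive_of_bound {q : U → ℝ} (hadd : ∀ h k, q (h + k) ≤ q h + q k)
    (hbd : ∀ h, |q h| ≤ K * ‖h‖) : Continuous q := by
  have hK : 0 ≤ K ∨ ∀ h : U, ‖h‖ = 0 := by
    by_contra! hc
    obtain ⟨hK, h, hh⟩ := hc
    have h1 := (abs_nonneg _).trans (hbd h)
    have h2 : 0 < ‖h‖ := lt_of_le_of_ne (norm_nonneg h) hh.symm
    nlinarith
  have key : ∀ h k, q h - q k ≤ K * ‖h - k‖ := fun h k => by
    have h1 := hadd k (h - k)
    have h2 := (le_abs_self _).trans (hbd (h - k))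
    rw [add_sub_cancel] at h1
    linarith
  refine (LipschitzWith.of_dist_le_mul (K := K.toNNReal) fun h k => ?_).continuous
  have h3 : K * ‖h - k‖ ≤ K.toNNReal * ‖h - k‖ :=
    mul_le_mul_of_nonneg_right (Real.le_coe_toNNReal K) (norm_nonneg _)
  rw [Real.dist_eq, dist_eq_norm, abs_le]
  have h4 := key k h
  rw [norm_sub_rev] at h4
  constructor <;> linarith [key h k]

/-- A Carathéodory function, continuous in `h` and measurable in `t`, is jointly measurable. -/
theorem integrable_comp_of_integrable [TopologicalSpace.SeparableSpace U]
    (hmeas : ∀ h, StronglyMeasurable fun t => p t h) (hcont : ∀ t, Continuous (p t))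
    (hbd : ∀ t h, |p t h| ≤ K * ‖h‖) {g : T → U} (hg : Integrable g μ) :
    Integrable (fun t => p t (g t)) μ := by
  have : SecondCountableTopology U := UniformSpace.secondCountable_of_separable U
  borelize U
  have h1 : StronglyMeasurable (Function.uncurry fun (h : U) (t : T) => p t h) :=
    stronglyMeasurable_uncurry_of_continuous_of_stronglyMeasurable hcont hmeas
  have h2 : AEStronglyMeasurable (fun t => p t (g t)) μ := by
    refine ⟨fun t => p t (hg.1.mk g t), h1.comp_measurable
      (hg.1.stronglyMeasurable_mk.measurable.prodMk measurable_id), ?_⟩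
    filter_upwards [hg.1.ae_eq_mk] with t ht
    rw [ht]
  exact (hg.norm.const_mul K).mono' h2 (Eventually.of_forall fun t => hbd t (g t))

theorem integral_norm_le_norm_Lp_two [IsProbabilityMeasure μ] (g : Lp U 2 μ) : ∫ t, ‖g t‖ ∂μ ≤ ‖g‖ := by
  rw [integral_norm_eq_lintegral_enorm (Lp.aestronglyMeasurable g), Lp.norm_def,
    ← eLpNorm_one_eq_lintegral_enorm]
  exact ENNReal.toReal_mono (Lp.eLpNorm_ne_top g)
    (eLpNorm_le_eLpNorm_of_exponent_le (by norm_num) (Lp.aestronglyMeasurable g))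

variable [IsProbabilityMeasure μ] [NormedSpace ℝ U] [TopologicalSpace.SeparableSpace U]

/-- Hahn–Banach: `hx'` says that `x'`, viewed on the constant functions, is dominated by the
sublinear functional `g ↦ ∫ p t (g t)`. The exponent 2 prepares for Riesz representation. -/
theorem exists_extension_Lp (hmeas : ∀ h, StronglyMeasurable fun t => p t h)
    (hadd : ∀ t h k, p t (h + k) ≤ p t h + p t k)
    (hsmul : ∀ t h (c : ℝ), 0 < c → p t (c • h) = c * p t h)
    (hbd : ∀ t h, |p t h| ≤ K * ‖h‖) (x' : StrongDual ℝ U)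
    (hx' : ∀ h, x' h ≤ ∫ t, p t h ∂μ) :
    ∃ Λ : Lp U 2 μ →L[ℝ] ℝ, (∀ h, Λ (Lp.constL 2 μ ℝ h) = x' h) ∧
      ∀ g : Lp U 2 μ, Λ g ≤ ∫ t, p t (g t) ∂μ := by
  have hcont : ∀ t, Continuous (p t) := fun t => continuous_of_subadditive_of_bound (hadd t) (hbd t)
  have hgi : ∀ g : Lp U 2 μ, Integrable g μ := fun g => (Lp.memLp g).integrable one_le_two
  have hpi : ∀ g : Lp U 2 μ, Integrable (fun t => p t (g t)) μ := fun g =>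
    integrable_comp_of_integrable hmeas hcont hbd (hgi g)
  let c : U →ₗ[ℝ] Lp U 2 μ := (Lp.constL 2 μ ℝ : U →L[ℝ] Lp U 2 μ)
  have hc : Function.Injective c := by
    refine (injective_iff_map_eq_zero c).2 fun h hh => ?_
    have h1 : ‖Lp.const 2 μ h‖ = 0 := by
      rw [show Lp.const 2 μ h = 0 from hh, norm_zero]
    rw [Lp.norm_const _ _ _ (by norm_num)] at h1
    simpa using h1
  have hcae : ∀ h, c h =ᵐ[μ] fun _ => h := fun h => Lp.coeFn_const 2 μ h
  have hhom : ∀ a : ℝ, 0 < a → ∀ g : Lp U 2 μ,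
      ∫ t, p t ((a • g : Lp U 2 μ) t) ∂μ = a * ∫ t, p t (g t) ∂μ := by
    intro a ha g
    rw [← integral_const_mul]
    refine integral_congr_ae ?_
    filter_upwards [Lp.coeFn_smul a g] with t ht
    rw [ht, Pi.smul_apply, hsmul t _ a ha]
  have hsub : ∀ g g' : Lp U 2 μ, ∫ t, p t ((g + g' : Lp U 2 μ) t) ∂μ ≤
      ∫ t, p t (g t) ∂μ + ∫ t, p t (g' t) ∂μ := by
    intro g g'
    rw [← integral_add (hpi g) (hpi g')]
    refine integral_mono_ae (hpi _) ((hpi g).add (hpi g')) ?_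
    filter_upwards [Lp.coeFn_add g g'] with t ht
    rw [ht, Pi.add_apply]
    exact hadd t _ _
  have hdom : ∀ g : LinearMap.range c,
      x' ((LinearEquiv.ofInjective c hc).symm g) ≤ ∫ t, p t ((g : Lp U 2 μ) t) ∂μ := by
    rintro ⟨_, h, rfl⟩
    change x' ((LinearEquiv.ofInjective c hc).symm (LinearEquiv.ofInjective c hc h)) ≤
      ∫ t, p t (c h t) ∂μ
    rw [LinearEquiv.symm_apply_apply]
    refine (hx' h).trans_eq (integral_congr_ae ?_)
    filter_upwards [hcae h] with t ht
    rw [ht]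
  obtain ⟨Λ, h1, h2⟩ := exists_extension_of_le_sublinear
    ⟨LinearMap.range c, x'.toLinearMap ∘ₗ (LinearEquiv.ofInjective c hc).symm.toLinearMap⟩
    (fun g : Lp U 2 μ => ∫ t, p t (g t) ∂μ) hhom hsub hdom
  have hΛ : ∀ g, ‖Λ g‖ ≤ |K| * ‖g‖ := by
    have h3 : ∀ g, Λ g ≤ |K| * ‖g‖ := fun g => by
      refine (h2 g).trans ?_
      calc ∫ t, p t (g t) ∂μ ≤ ∫ t, |K| * ‖g t‖ ∂μ := by
            refine integral_mono (hpi g) ((hgi g).norm.const_mul _) fun t => ?_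
            exact ((le_abs_self _).trans (hbd t _)).trans
              (mul_le_mul_of_nonneg_right (le_abs_self K) (norm_nonneg _))
        _ ≤ |K| * ‖g‖ := by
            rw [integral_const_mul]
            exact mul_le_mul_of_nonneg_left (integral_norm_le_norm_Lp_two g) (abs_nonneg K)
    intro g
    have h4 := h3 (-g)
    rw [map_neg, norm_neg] at h4
    rw [Real.norm_eq_abs, abs_le]
    constructor <;> linarith [h3 g]
  refine ⟨Λ.mkContinuous |K| hΛ, fun h => ?_, h2⟩
  have h3 := h1 ⟨c h, LinearMap.mem_range_self c h⟩
  refine h3.trans ?_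
  change x' ((LinearEquiv.ofInjective c hc).symm (LinearEquiv.ofInjective c hc h)) = x' h
  rw [LinearEquiv.symm_apply_apply]

/-- The densities representing `x'` in each direction. -/
theorem exists_Lp_density (hmeas : ∀ h, StronglyMeasurable fun t => p t h)
    (hadd : ∀ t h k, p t (h + k) ≤ p t h + p t k)
    (hsmul : ∀ t h (c : ℝ), 0 < c → p t (c • h) = c * p t h)
    (hbd : ∀ t h, |p t h| ≤ K * ‖h‖) (x' : StrongDual ℝ U)
    (hx' : ∀ h, x' h ≤ ∫ t, p t h ∂μ) :
    ∃ Y : U → Lp ℝ 2 μ, (∀ h k, Y (h + k) = Y h + Y k) ∧ (∀ h, ∀ᵐ t ∂μ, Y h t ≤ p t h) ∧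
      ∀ h, ∫ t, Y h t ∂μ = x' h := by
  obtain ⟨Λ, hΛ, hΛp⟩ := exists_extension_Lp hmeas hadd hsmul hbd x' hx'
  have hcont : ∀ t, Continuous (p t) := fun t => continuous_of_subadditive_of_bound (hadd t) (hbd t)
  have hp0 : ∀ t, p t 0 = 0 := fun t => by simpa using hbd t 0
  have hpint : ∀ h, Integrable (fun t => p t h) μ := fun h =>
    integrable_comp_of_integrable hmeas hcont hbd (integrable_const h)
  let E : U → Lp ℝ 2 μ →L[ℝ] Lp U 2 μ := fun h =>
    (ContinuousLinearMap.toSpanSingleton ℝ h).compLpL 2 μ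
  -- The Riesz representative of `f ↦ Λ (f · h)` on scalar L².
  let Y : U → Lp ℝ 2 μ := fun h => (InnerProductSpace.toDual ℝ (Lp ℝ 2 μ)).symm (Λ.comp (E h))
  have hYint : ∀ h (B : Set T) (hB : MeasurableSet B),
      ∫ t in B, Y h t ∂μ = Λ (E h (indicatorConstLp 2 hB (measure_ne_top μ B) (1 : ℝ))) := by
    intro h B hB
    rw [← L2.inner_indicatorConstLp_one (𝕜 := ℝ) hB (measure_ne_top μ B) (Y h), real_inner_comm]
    exact InnerProductSpace.toDual_symm_apply
  have hEae : ∀ h (B : Set T) (hB : MeasurableSet B),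
      E h (indicatorConstLp 2 hB (measure_ne_top μ B) (1 : ℝ)) =ᵐ[μ] B.indicator fun _ => h := by
    intro h B hB
    filter_upwards [ContinuousLinearMap.coeFn_compLpL (p := 2)
      (ContinuousLinearMap.toSpanSingleton ℝ h) (indicatorConstLp 2 hB (measure_ne_top μ B) (1 : ℝ)),
      indicatorConstLp_coeFn (p := 2) (hs := hB) (hμs := measure_ne_top μ B) (c := (1 : ℝ))]
      with t h1 h2
    rw [h1, h2]
    by_cases ht : t ∈ B <;> simp [ht]
  refine ⟨Y, fun h k => ?_, fun h => ?_, fun h => ?_⟩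
  · have : E (h + k) = E h + E k := by
      simp only [E]
      rw [ContinuousLinearMap.toSpanSingleton_add, ContinuousLinearMap.add_compLpL]
    simp only [Y]
    rw [this, ContinuousLinearMap.comp_add, map_add]
  -- Testing `Λ` on `1_B · h` compares the integrals over every measurable `B`.
  · refine ae_le_of_forall_setIntegral_le ((Lp.memLp (Y h)).integrable one_le_two) (hpint h)
      fun B hB _ => ?_
    rw [hYint h B hB, ← integral_indicator hB]
    refine (hΛp _).trans_eq (integral_congr_ae ?_)
    filter_upwards [hEae h B hB] with t ht
    rw [ht]
    by_cases htB : t ∈ B <;> simp [htB, hp0]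
  · rw [← setIntegral_univ, hYint h _ MeasurableSet.univ, ← hΛ h]
    congr 1
    refine Lp.ext ?_
    filter_upwards [hEae h _ MeasurableSet.univ] with t ht
    rw [ht]
    simp

/-- Strassen's disintegration theorem for a measurable family of sublinear functions on a separable
normed space. -/
theorem exists_selection_of_le_integral (hmeas : ∀ h, StronglyMeasurable fun t => p t h)
    (hadd : ∀ t h k, p t (h + k) ≤ p t h + p t k)
    (hsmul : ∀ t h (c : ℝ), 0 < c → p t (c • h) = c * p t h)
    (hbd : ∀ t h, |p t h| ≤ K * ‖h‖) (x' : StrongDual ℝ U)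
    (hx' : ∀ h, x' h ≤ ∫ t, p t h ∂μ) :
    ∃ s : T → StrongDual ℝ U, (∀ h, Measurable fun t => s t h) ∧
      (∀ᵐ t ∂μ, ∀ h, s t h ≤ p t h) ∧
      ∀ h, Integrable (fun t => s t h) μ ∧ x' h = ∫ t, s t h ∂μ := by
  classical
  obtain ⟨Y, hYadd, hYle, hYint⟩ := exists_Lp_density hmeas hadd hsmul hbd x' hx'
  obtain ⟨D, hDc, hDd⟩ := exists_countable_dense_submodule U
  have hcont : ∀ t, Continuous (p t) := fun t => continuous_of_subadditive_of_bound (hadd t) (hbd t)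
  -- Countability of `D` puts all exceptional sets into one null set; on its measurable hull `G` the
  -- selection is set to zero, which keeps it measurable everywhere.
  have hgood : ∀ᵐ t ∂μ, (∀ d ∈ D, ∀ e ∈ D, Y (d + e) t = Y d t + Y e t) ∧
      ∀ d ∈ D, Y d t ≤ p t d := by
    refine Eventually.and ?_ ((ae_ball_iff hDc).2 fun d _ => hYle d)
    refine (ae_ball_iff hDc).2 fun d _ => (ae_ball_iff hDc).2 fun e _ => ?_
    rw [hYadd]
    exact Lp.coeFn_add _ _
  obtain ⟨G, hGsub, hGmeas, hGnull⟩ := exists_measurable_superset_of_null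
    (show μ {t | ¬ ((∀ d ∈ D, ∀ e ∈ D, Y (d + e) t = Y d t + Y e t) ∧ ∀ d ∈ D, Y d t ≤ p t d)} = 0
      from hgood)
  have hG : ∀ t ∉ G, (∀ d ∈ D, ∀ e ∈ D, Y (d + e) t = Y d t + Y e t) ∧ ∀ d ∈ D, Y d t ≤ p t d :=
    fun t ht => not_not.1 fun hc => ht (hGsub hc)
  have hex : ∀ t, ∃ s : StrongDual ℝ U, (t ∈ G → s = 0) ∧ (t ∉ G → ∀ d ∈ D, s d = Y d t) := by
    intro t
    by_cases ht : t ∈ G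
    · exact ⟨0, fun _ => rfl, fun h => absurd ht h⟩
    · obtain ⟨h1, h2⟩ := hG t ht
      have h3 : Y 0 t = 0 := by simpa using h1 0 D.zero_mem 0 D.zero_mem
      obtain ⟨s, hs⟩ := exists_strongDual_eqOn_of_dense D hDd (fun d => Y d t) (K := K) h1
        fun d hd => by
          have h4 := h1 d hd (-d) (D.neg_mem hd)
          rw [add_neg_cancel, h3] at h4
          have h5 := (h2 d hd).trans ((le_abs_self _).trans (hbd t d))
          have h6 := (h2 (-d) (D.neg_mem hd)).trans ((le_abs_self _).trans (hbd t (-d)))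
          rw [norm_neg] at h6
          rw [abs_le]
          constructor <;> linarith
      exact ⟨s, fun h => absurd h ht, fun _ => hs⟩
  choose s hs0 hs using hex
  have hsp : ∀ t ∉ G, ∀ h, s t h ≤ p t h := fun t ht h => by
    have hcl : IsClosed {h | s t h ≤ p t h} := isClosed_le (s t).continuous (hcont t)
    have : (D : Set U) ⊆ {h | s t h ≤ p t h} := fun d hd => by
      simpa [hs t ht d hd] using (hG t ht).2 d hd
    have h1 := (hcl.closure_subset_iff.2 this) (hDd h)
    exact h1
  have hsK : ∀ t h, |s t h| ≤ |K| * ‖h‖ := fun t h => by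
    by_cases ht : t ∈ G
    · simp only [hs0 t ht, zero_apply, abs_zero]
      positivity
    · have h1 := (hsp t ht h).trans ((le_abs_self _).trans (hbd t h))
      have h2 := (hsp t ht (-h)).trans ((le_abs_self _).trans (hbd t (-h)))
      rw [map_neg, norm_neg] at h2
      have h3 := mul_le_mul_of_nonneg_right (le_abs_self K) (norm_nonneg h)
      rw [abs_le]
      constructor <;> linarith
  have hnot : ∀ᵐ t ∂μ, t ∉ G := measure_eq_zero_iff_ae_notMem.1 hGnull
  have hsmeas : ∀ h, Measurable fun t => s t h := by
    have hD : ∀ d ∈ D, Measurable fun t => s t d := fun d hd => by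
      have : (fun t => s t d) = G.piecewise (fun _ => 0) (Y d) := by
        funext t
        by_cases ht : t ∈ G
        · simp [ht, hs0 t ht]
        · simp [ht, hs t ht d hd]
      rw [this]
      exact Measurable.piecewise hGmeas measurable_const (Lp.stronglyMeasurable (Y d)).measurable
    intro h
    obtain ⟨d, hd, hlim⟩ := mem_closure_iff_seq_limit.1 (hDd h)
    exact measurable_of_tendsto_metrizable (fun n => hD (d n) (hd n))
      (tendsto_pi_nhds.2 fun t => ((s t).continuous.tendsto h).comp hlim)
  have hsint : ∀ h, Integrable (fun t => s t h) μ := fun h =>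
    Integrable.of_bound (hsmeas h).aestronglyMeasurable (|K| * ‖h‖)
      (Eventually.of_forall fun t => hsK t h)
  refine ⟨s, hsmeas, hnot.mono hsp, fun h => ⟨hsint h, ?_⟩⟩
  -- The integral identity is known on `D` and passes to `U` by density.
  have hc : Continuous fun h => ∫ t, s t h ∂μ :=
    continuous_of_subadditive_of_bound (K := |K|)
      (fun h k => by
        rw [← integral_add (hsint h) (hsint k)]
        simp)
      fun h => by
        have := norm_integral_le_of_norm_le_const (μ := μ) (f := fun t => s t h)
          (Eventually.of_forall fun t => hsK t h)
        simpa using this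
  refine congrFun (hDd.denseRange_val.equalizer x'.continuous hc (funext fun d => ?_)) h
  simp only [Function.comp_apply]
  rw [← hYint d]
  refine integral_congr_ae ?_
  filter_upwards [hnot] with t ht
  exact (hs t ht d d.2).symm

end Disintegration

/-- The Clarke subdifferential of an integral functional whose integrands have regular upper
derivatives is the Aumann integral of the Clarke subdifferentials. -/
theorem clarkeSubdifferential_integral_eq_aumannIntegral {T : Type*} [MeasurableSpace T]
    {μ : Measure T} [IsProbabilityMeasure μ] {U : Type*} [NormedAddCommGroup U] [NormedSpace ℝ U]
    [TopologicalSpace.SeparableSpace U] {F : U → T → ℝ} (hFm : ∀ u, StronglyMeasurable (F u))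
    (hF : ∀ u, Integrable (F u) μ) {x : U} {K : NNReal} {N : Set U} (hN : N ∈ 𝓝 x)
    (hLip : ∀ t, LipschitzOnWith K (fun u => F u t) N)
    (hreg : ∀ t h, ∃ p, HasRegularUpperDeriv (fun u => F u t) x h p) :
    clarkeSubdifferential (fun u => ∫ t, F u t ∂μ) x =
      aumannIntegral μ fun t => clarkeSubdifferential (fun u => F u t) x := by
  choose p hp using hreg
  have hint := fun h => HasRegularUpperDeriv.integral hF hN hLip fun t => hp t h
  have hleft : clarkeSubdifferential (fun u => ∫ t, F u t ∂μ) x =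
      {x' | ∀ h, x' h ≤ ∫ t, p t h ∂μ} := by
    ext x'
    simp only [clarkeSubdifferential, (hint _).2.clarkeDeriv_eq, Set.mem_ofPred_eq,
      EReal.coe_le_coe_iff]
  have hright : ∀ t, clarkeSubdifferential (fun u => F u t) x = {x' | ∀ h, x' h ≤ p t h} := by
    intro t
    ext x'
    simp only [clarkeSubdifferential, (hp t _).clarkeDeriv_eq, Set.mem_ofPred_eq,
      EReal.coe_le_coe_iff]
  simp only [hleft, hright, aumannIntegral]
  ext x'
  -- Forward is Strassen's theorem for the sublinear family `p t`; backward is monotonicity of the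
  -- integral.
  refine ⟨fun hx' => ?_, ?_⟩
  · refine exists_selection_of_le_integral (p := p) (K := K) (fun h => ?_)
      (fun t h k => (hp t h).le_add (hp t k) (hp t (h + k)))
      (fun t h c hc => (hp t h).smul_eq hc (hp t (c • h)))
      (fun t h => (hp t h).abs_le hN (hLip t)) x' hx'
    exact stronglyMeasurable_of_tendsto (𝓝[>] (0 : ℝ))
      (fun s => (((hFm x).measurable.sub (hFm (x - s • h)).measurable).div_const
        s).stronglyMeasurable)
      (tendsto_pi_nhds.2 fun t => (hp t h).tendsto)
  · rintro ⟨s, -, hs, hs'⟩ h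
    rw [(hs' h).2]
    refine integral_mono_ae (hs' h).1 (hint h).1 ?_
    filter_upwards [hs] with t ht
    exact ht h

/-! ### Concave functions and the chain rule. -/

section Concave

variable {X : Type*} [NormedAddCommGroup X] [NormedSpace ℝ X] {ρ : X → ℝ} {x h : X} {δ p : ℝ}

/-- A concave Lipschitz function has regular upper derivatives. -/
theorem ConcaveOn.exists_hasRegularUpperDeriv {K : NNReal} (hδ : 0 < δ)
    (hρ : ConcaveOn ℝ (Metric.ball x δ) ρ) (hLip : LipschitzOnWith K ρ (Metric.ball x δ)) (h : X) :
    ∃ p, HasRegularUpperDeriv ρ x h p := by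
  have hball := Metric.ball_mem_nhds x hδ
  have hx : x ∈ Metric.ball x δ := Metric.mem_ball_self hδ
  obtain ⟨b, hb0, hb⟩ : ∃ b > 0, ∀ s ∈ Set.Ioo 0 b, x - s • h ∈ Metric.ball x δ :=
    (mem_nhdsGT_iff_exists_Ioo_subset (a := (0 : ℝ))).1 (tendsto_sub_smul_nhdsGT x h hball)
  let φ : ℝ → ℝ := fun s => (ρ x - ρ (x - s • h)) / s
  -- By concavity the left quotients decrease as `s ↓ 0`; the Lipschitz bound keeps their limit
  -- finite.
  have hmono : MonotoneOn φ (Set.Ioo 0 b) := by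
    intro s hs s' hs' hss
    have hs0 : 0 < s := hs.1
    have hs0' : 0 < s' := hs'.1
    have h0 : 0 ≤ 1 - s / s' := by
      rw [sub_nonneg, div_le_one hs0']
      exact hss
    have h1 := hρ.2 hx (hb s' hs') h0 (div_pos hs0 hs0').le (sub_add_cancel _ _)
    have h2 : (1 - s / s') • x + (s / s') • (x - s' • h) = x - s • h := by
      rw [smul_sub, smul_smul, div_mul_cancel₀ _ hs0'.ne', sub_smul, one_smul]
      abel
    rw [h2, smul_eq_mul, smul_eq_mul] at h1
    change (ρ x - ρ (x - s • h)) / s ≤ (ρ x - ρ (x - s' • h)) / s'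
    rw [div_le_iff₀ hs0]
    have h3 : (ρ x - ρ (x - s' • h)) / s' * s = s / s' * (ρ x - ρ (x - s' • h)) := by ring
    rw [h3]
    linarith
  have hbdd : BddBelow (φ '' Set.Ioo 0 b) := by
    refine ⟨-(K * ‖h‖), ?_⟩
    rintro _ ⟨s, hs, rfl⟩
    have hs0 : 0 < s := hs.1
    have h1 := hLip.dist_le_mul x hx _ (hb s hs)
    rw [Real.dist_eq, dist_eq_norm, sub_sub_cancel, norm_smul, Real.norm_eq_abs, abs_of_pos hs0]
      at h1
    change -(K * ‖h‖) ≤ (ρ x - ρ (x - s • h)) / s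
    rw [le_div_iff₀ hs0]
    linarith [(abs_le.1 h1).1]
  have hlim := hmono.tendsto_nhdsWithin_Ioo_right (Set.nonempty_Ioo.2 hb0) hbdd
  refine ⟨_, hlim, fun c hc => ?_⟩
  -- With one step `s` frozen, the left quotient stays below `c` for base points near `x` by
  -- continuity; concavity then bounds every forward quotient there by it.
  obtain ⟨s, hsc, hs⟩ := ((hlim.eventually (gt_mem_nhds hc)).and (Ioo_mem_nhdsGT hb0)).exists
  have hs0 : 0 < s := hs.1
  have hcont : ContinuousAt (fun u => (ρ u - ρ (u - s • h)) / s) x := by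
    have h1 : ContinuousAt ρ x := hLip.continuousOn.continuousAt hball
    have h2 : ContinuousAt ρ (x - s • h) :=
      hLip.continuousOn.continuousAt (Metric.isOpen_ball.mem_nhds (hb s hs))
    have h3 : ContinuousAt (fun u => ρ (u - s • h)) x :=
      ContinuousAt.comp (f := fun u : X => u - s • h) h2 (by fun_prop)
    exact (h1.sub h3).div_const s
  have hshift : ∀ᶠ u in 𝓝 x, u - s • h ∈ Metric.ball x δ := by
    have : ContinuousAt (fun u : X => u - s • h) x := by fun_prop
    exact this (Metric.isOpen_ball.mem_nhds (hb s hs))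
  filter_upwards [tendsto_fst.eventually (hcont.eventually (gt_mem_nhds hsc)),
    tendsto_fst.eventually hshift, tendsto_add_smul_prod_nhdsGT x h hball,
    tendsto_snd self_mem_nhdsWithin] with q h1 h2 h3 (h4 : 0 < q.2)
  have hst : 0 < s + q.2 := by positivity
  have h5 := hρ.2 h2 h3 (div_pos h4 hst).le (div_pos hs0 hst).le
    (by rw [← add_div, add_comm q.2, div_self hst.ne'])
  have h6 : (q.2 / (s + q.2)) • (q.1 - s • h) + (s / (s + q.2)) • (q.1 + q.2 • h) = q.1 := by
    rw [smul_sub, smul_add, smul_smul, smul_smul]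
    have h7 : q.2 / (s + q.2) * s = s / (s + q.2) * q.2 := by ring
    have h8 : q.1 = (q.2 / (s + q.2) + s / (s + q.2)) • q.1 := by
      rw [← add_div, add_comm q.2, div_self hst.ne', one_smul]
    conv_rhs => rw [h8, add_smul]
    rw [h7]
    abel
  rw [h6, smul_eq_mul, smul_eq_mul, div_mul_eq_mul_div, div_mul_eq_mul_div, ← add_div,
    div_le_iff₀ hst] at h5
  refine le_trans ?_ h1.le
  rw [div_le_div_iff₀ h4 hs0]
  linarith

/-- The chain rule for regular upper derivatives. -/
theorem HasRegularUpperDeriv.comp {K : NNReal} {N : Set X} (hN : N ∈ 𝓝 x)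
    (hLip : LipschitzOnWith K ρ N) (hp : HasRegularUpperDeriv ρ x h p) {G : ℝ → ℝ} {G' : ℝ}
    (hG : HasStrictDerivAt G G' (ρ x)) (hG' : 0 ≤ G') :
    HasRegularUpperDeriv (fun u => G (ρ u)) x h (G' * p) := by
  -- The linearization error. Both arguments of `G` move, hence the need for strict
  -- differentiability.
  let D : X × ℝ → ℝ := fun q =>
    (G (ρ (q.1 + q.2 • h)) - G (ρ q.1)) / q.2 - G' * ((ρ (q.1 + q.2 • h) - ρ q.1) / q.2)
  have hcont : ContinuousAt ρ x := hLip.continuousOn.continuousAt hN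
  have hpair : Tendsto (fun q : X × ℝ => (ρ (q.1 + q.2 • h), ρ q.1)) (𝓝 x ×ˢ 𝓝[>] (0 : ℝ))
      (𝓝 (ρ x, ρ x)) := by
    rw [nhds_prod_eq]
    exact (hcont.tendsto.comp (tendsto_add_smul_prod_nhdsGT x h)).prodMk
      (hcont.tendsto.comp tendsto_fst)
  have hD : Tendsto D (𝓝 x ×ˢ 𝓝[>] (0 : ℝ)) (𝓝 0) := by
    rw [Metric.tendsto_nhds]
    intro ε hε
    have hη : 0 < ε / (K * ‖h‖ + 1) := by positivity
    have h1 := hG.hasStrictFDerivAt.isLittleO.def hη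
    filter_upwards [hpair.eventually h1, tendsto_add_smul_prod_nhdsGT x h hN, tendsto_fst hN,
      tendsto_snd self_mem_nhdsWithin] with q h2 h3 h4 (h5 : 0 < q.2)
    have h6 := hLip.dist_le_mul _ h3 _ h4
    rw [dist_eq_norm, dist_eq_norm, add_sub_cancel_left, norm_smul, Real.norm_of_nonneg h5.le] at h6
    have h7 : D q = (G (ρ (q.1 + q.2 • h)) - G (ρ q.1) -
        (ρ (q.1 + q.2 • h) - ρ q.1) • G') / q.2 := by
      simp only [D, smul_eq_mul]
      ring
    rw [dist_zero_right, h7, norm_div, Real.norm_of_nonneg h5.le, div_lt_iff₀ h5]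
    calc _ ≤ ε / (K * ‖h‖ + 1) * ‖ρ (q.1 + q.2 • h) - ρ q.1‖ := h2
      _ ≤ ε / (K * ‖h‖ + 1) * (K * (q.2 * ‖h‖)) := by gcongr
      _ = ε * q.2 * (K * ‖h‖ / (K * ‖h‖ + 1)) := by ring
      _ < ε * q.2 * 1 := by
        refine mul_lt_mul_of_pos_left ?_ (by positivity)
        rw [div_lt_one (by positivity)]
        linarith
      _ = ε * q.2 := mul_one _
  refine ⟨?_, fun c hc => ?_⟩
  · have h1 := (hD.comp (tendsto_sub_smul_prodMk x h)).add (hp.tendsto.const_mul G')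
    rw [zero_add] at h1
    refine h1.congr fun s => ?_
    simp only [D, Function.comp_apply, sub_add_cancel]
  -- This margin `η` solves `η + G' * (p + η) = c`.
  · have hη : 0 < (c - G' * p) / (G' + 1) := div_pos (by linarith) (by linarith)
    filter_upwards [hD.eventually (gt_mem_nhds hη),
      hp.eventually_le (p + (c - G' * p) / (G' + 1)) (by linarith)] with q h1 h2
    have h3 := mul_le_mul_of_nonneg_left h2 hG'
    have h4 : (c - G' * p) / (G' + 1) + G' * (p + (c - G' * p) / (G' + 1)) = c := by
      field_simp
      ring
    simp only [D] at h1
    linarith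

end Concave

/-! ### Scaling and distribution function of the chi law. -/

theorem continuous_chiDensity (m : ℕ) : Continuous (chiDensity m) := by
  unfold chiDensity
  fun_prop

theorem chiDensity_nonneg {m : ℕ} (hm : 0 < m) {r : ℝ} (hr : 0 ≤ r) : 0 ≤ chiDensity m r := by
  have := Real.Gamma_pos_of_pos (by positivity : (0 : ℝ) < m / 2)
  unfold chiDensity
  positivity

/-- The power `r ^ (m - 1)` scales exactly, and the Gaussian factor only grows when `r` shrinks. -/
theorem pow_mul_chiDensity_le {m : ℕ} (hm : 0 < m) {c r : ℝ} (hc0 : 0 < c) (hc1 : c ≤ 1)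
    (hr : 0 ≤ r) : c ^ m * chiDensity m r ≤ c * chiDensity m (c * r) := by
  have hG := Real.Gamma_pos_of_pos (by positivity : (0 : ℝ) < m / 2)
  have h1 : Real.exp (-r ^ 2 / 2) ≤ Real.exp (-(c * r) ^ 2 / 2) := by
    rw [Real.exp_le_exp, mul_pow]
    have : c ^ 2 * r ^ 2 ≤ 1 * r ^ 2 :=
      mul_le_mul_of_nonneg_right (pow_le_one₀ hc0.le hc1) (sq_nonneg r)
    linarith
  obtain ⟨k, rfl⟩ : ∃ k, m = k + 1 := ⟨m - 1, by omega⟩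
  simp only [chiDensity, Nat.add_sub_cancel]
  set C := (2 : ℝ) ^ (1 - ((k + 1 : ℕ) : ℝ) / 2) / Real.Gamma (((k + 1 : ℕ) : ℝ) / 2) with hC
  have hC0 : 0 ≤ C := by positivity
  calc c ^ (k + 1) * (C * r ^ k * Real.exp (-r ^ 2 / 2))
      = c ^ (k + 1) * (C * r ^ k) * Real.exp (-r ^ 2 / 2) := by ring
    _ ≤ c ^ (k + 1) * (C * r ^ k) * Real.exp (-(c * r) ^ 2 / 2) :=
      mul_le_mul_of_nonneg_left h1 (by positivity)
    _ = c * (C * (c * r) ^ k * Real.exp (-(c * r) ^ 2 / 2)) := by ring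

theorem lintegral_comp_mul_left_Ioi {c : ℝ} (hc : 0 < c) {f : ℝ → ENNReal} (hf : Measurable f) :
    ENNReal.ofReal c * ∫⁻ r in Set.Ioi (0 : ℝ), f (c * r) = ∫⁻ r in Set.Ioi (0 : ℝ), f r := by
  rw [← lintegral_indicator measurableSet_Ioi, ← lintegral_indicator measurableSet_Ioi]
  conv_rhs => rw [← Real.smul_map_volume_mul_left hc.ne']
  rw [lintegral_smul_measure, lintegral_map (hf.indicator measurableSet_Ioi) (by fun_prop),
    abs_of_pos hc, smul_eq_mul]
  congr 1
  refine lintegral_congr fun r => ?_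
  have : r ∈ Set.Ioi (0 : ℝ) ↔ c * r ∈ Set.Ioi (0 : ℝ) := by simp [hc]
  by_cases h : r ∈ Set.Ioi (0 : ℝ)
  · rw [Set.indicator_of_mem h, Set.indicator_of_mem (this.1 h)]
  · rw [Set.indicator_of_notMem h, Set.indicator_of_notMem (mt this.2 h)]

theorem pow_mul_chiMeasure_le {m : ℕ} (hm : 0 < m) {c : ℝ} (hc0 : 0 < c) (hc1 : c ≤ 1)
    {S S' : Set ℝ} (hS : MeasurableSet S) (hS' : MeasurableSet S')
    (hSS' : ∀ r ∈ S, c * r ∈ S') :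
    ENNReal.ofReal (c ^ m) * chiMeasure m S ≤ chiMeasure m S' := by
  have hmeas : Measurable fun r => S'.indicator (1 : ℝ → ENNReal) r *
      ENNReal.ofReal (chiDensity m r) :=
    (measurable_one.indicator hS').mul (measurable_chiDensity m).ennreal_ofReal
  rw [chiMeasure_apply m hS, chiMeasure_apply m hS', ← lintegral_comp_mul_left_Ioi hc0 hmeas,
    ← lintegral_const_mul' _ _ ENNReal.ofReal_ne_top,
    ← lintegral_const_mul' _ _ ENNReal.ofReal_ne_top]
  refine setLIntegral_mono' measurableSet_Ioi fun r (hr : 0 < r) => ?_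
  by_cases h : r ∈ S
  · rw [Set.indicator_of_mem h, Set.indicator_of_mem (hSS' r h)]
    simp only [Pi.one_apply, one_mul]
    rw [← ENNReal.ofReal_mul (by positivity), ← ENNReal.ofReal_mul hc0.le]
    exact ENNReal.ofReal_le_ofReal (pow_mul_chiDensity_le hm hc0 hc1 hr.le)
  · simp [h]

theorem chiMeasure_real_Icc {m : ℕ} (hm : 0 < m) {b : ℝ} (hb : 0 ≤ b) :
    (chiMeasure m).real (Set.Icc 0 b) = ∫ r in (0 : ℝ)..b, chiDensity m r := by
  have h1 : chiMeasure m (Set.Icc 0 b) = ∫⁻ r in Set.Ioc (0 : ℝ) b,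
      ENNReal.ofReal (chiDensity m r) := by
    rw [chiMeasure, withDensity_apply _ measurableSet_Icc,
      Measure.restrict_restrict measurableSet_Icc]
    congr 2
    ext r
    simp only [Set.mem_inter_iff, Set.mem_Icc, Set.mem_Ioi, Set.mem_Ioc]
    grind
  rw [intervalIntegral.integral_of_le hb, measureReal_def, h1,
    integral_eq_lintegral_of_nonneg_ae _ (continuous_chiDensity m).aestronglyMeasurable]
  filter_upwards [ae_restrict_mem measurableSet_Ioc] with r hr
  exact chiDensity_nonneg hm hr.1.le

theorem hasStrictDerivAt_integral_chiDensity (m : ℕ) (b : ℝ) :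
    HasStrictDerivAt (fun b => ∫ r in (0 : ℝ)..b, chiDensity m r) (chiDensity m b) b :=
  intervalIntegral.integral_hasStrictDerivAt_right
    ((continuous_chiDensity m).intervalIntegrable _ _)
    ((continuous_chiDensity m).stronglyMeasurableAtFilter _ _)
    (continuous_chiDensity m).continuousAt

/-! ### Admissible radii along a ray. -/

section Ray

variable {U E : Type*} [NormedAddCommGroup U] [NormedAddCommGroup E]
  [NormedSpace ℝ E] {g : U → E → ℝ}

/-- The set of admissible radii `r ≥ 0` with `g u (r w) ≤ 0` in the direction `w`. -/
def admissibleRadii (g : U → E → ℝ) (w : E) (u : U) : Set ℝ :=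
  {r : ℝ | 0 ≤ r ∧ g u (r • w) ≤ 0}

theorem isClosed_admissibleRadii (hg : Continuous fun p : U × E => g p.1 p.2) (w : E) (u : U) :
    IsClosed (admissibleRadii g w u) := by
  have h1 : Continuous fun r : ℝ => g u (r • w) :=
    hg.comp (f := fun r : ℝ => (u, r • w)) (by fun_prop)
  exact isClosed_Ici.inter (isClosed_le h1 continuous_const)

variable [NormedSpace ℝ U]

/-- Joint convexity makes the graph of `u ↦ admissibleRadii g w u` convex: this yields intervals,
concavity of the largest radius and the shrinking argument alike. -/
theorem convexComb_mem_admissibleRadii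
    (hg : ConvexOn ℝ Set.univ fun p : U × E => g p.1 p.2) {w : E} {u u' : U} {r r' a b : ℝ}
    (hr : r ∈ admissibleRadii g w u) (hr' : r' ∈ admissibleRadii g w u') (ha : 0 ≤ a)
    (hb : 0 ≤ b) (hab : a + b = 1) :
    a * r + b * r' ∈ admissibleRadii g w (a • u + b • u') := by
  refine ⟨add_nonneg (mul_nonneg ha hr.1) (mul_nonneg hb hr'.1), ?_⟩
  have h1 := hg.2 (Set.mem_univ (u, r • w)) (Set.mem_univ (u', r' • w)) ha hb hab
  simp only [Prod.smul_mk, Prod.mk_add_mk, smul_smul, ← add_smul, smul_eq_mul] at h1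
  nlinarith [mul_nonpos_of_nonneg_of_nonpos ha hr.2, mul_nonpos_of_nonneg_of_nonpos hb hr'.2]

theorem lt_of_mem_admissibleRadii (hg : ConvexOn ℝ Set.univ fun p : U × E => g p.1 p.2) {w : E}
    {u : U} {r R : ℝ} (h0 : g u 0 ≤ 0) (hR0 : 0 ≤ R) (hR : 0 < g u (R • w))
    (hr : r ∈ admissibleRadii g w u) : r < R := by
  by_contra! hRr
  rcases hRr.eq_or_lt with rfl | hlt
  · exact absurd hr.2 (not_le.2 hR)
  have hr0 : 0 < r := hR0.trans_lt hlt
  have hz : (0 : ℝ) ∈ admissibleRadii g w u := ⟨le_rfl, by simpa using h0⟩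
  have ha : 0 ≤ 1 - R / r := by
    rw [sub_nonneg, div_le_one hr0]
    exact hRr
  have h1 := convexComb_mem_admissibleRadii hg hz hr ha (div_nonneg hR0 hr0.le)
    (sub_add_cancel _ _)
  rw [← add_smul, sub_add_cancel, one_smul, mul_zero, zero_add, div_mul_cancel₀ _ hr0.ne'] at h1
  exact absurd h1.2 (not_le.2 hR)

theorem admissibleRadii_eq_Icc (hgc : Continuous fun p : U × E => g p.1 p.2)
    (hg : ConvexOn ℝ Set.univ fun p : U × E => g p.1 p.2) {w : E} {u : U} {R : ℝ}
    (h0 : g u 0 ≤ 0) (hR0 : 0 ≤ R) (hR : 0 < g u (R • w)) :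
    admissibleRadii g w u = Set.Icc 0 (sSup (admissibleRadii g w u)) ∧
      sSup (admissibleRadii g w u) ∈ admissibleRadii g w u := by
  have hz : (0 : ℝ) ∈ admissibleRadii g w u := ⟨le_rfl, by simpa using h0⟩
  have hbdd : BddAbove (admissibleRadii g w u) :=
    ⟨R, fun r hr => (lt_of_mem_admissibleRadii hg h0 hR0 hR hr).le⟩
  have hmem := (isClosed_admissibleRadii hgc w u).csSup_mem ⟨0, hz⟩ hbdd
  refine ⟨Set.Subset.antisymm (fun r hr => ⟨hr.1, le_csSup hbdd hr⟩) fun r hr => ?_, hmem⟩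
  have hconv : Convex ℝ (admissibleRadii g w u) := by
    intro r hr r' hr' a b ha hb hab
    have := convexComb_mem_admissibleRadii hg hr hr' ha hb hab
    rwa [← add_smul, hab, one_smul] at this
  exact hconv.ordConnected.out hz hmem hr

theorem exists_hasRegularUpperDeriv_chiMeasure_admissibleRadii {m : ℕ} (hm : 0 < m)
    (hgc : Continuous fun p : U × E => g p.1 p.2)
    (hg : ConvexOn ℝ Set.univ fun p : U × E => g p.1 p.2) {u₀ : U} (h0 : g u₀ 0 < 0) {w : E}
    {R : ℝ} (hR0 : 0 < R) (hR : 0 < g u₀ (R • w)) (h : U) :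
    ∃ p, HasRegularUpperDeriv (fun u => (chiMeasure m).real (admissibleRadii g w u)) u₀ h p := by
  have hcz : ∀ z : E, Continuous fun u : U => g u z := fun z =>
    hgc.comp (f := fun u : U => (u, z)) (by fun_prop)
  obtain ⟨δ, hδ, hball⟩ := Metric.eventually_nhds_iff_ball.1
    (((hcz 0).continuousAt.eventually (gt_mem_nhds h0)).and
      ((hcz (R • w)).continuousAt.eventually (lt_mem_nhds hR)))
  let ρ : U → ℝ := fun u => sSup (admissibleRadii g w u)
  have hρ : ∀ u ∈ Metric.ball u₀ δ, admissibleRadii g w u = Set.Icc 0 (ρ u) ∧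
      ρ u ∈ admissibleRadii g w u := fun u hu =>
    admissibleRadii_eq_Icc hgc hg (hball u hu).1.le hR0.le (hball u hu).2
  have hconc : ConcaveOn ℝ (Metric.ball u₀ δ) ρ := by
    refine ⟨convex_ball u₀ δ, fun u hu u' hu' a b ha hb hab => ?_⟩
    have h1 := convexComb_mem_admissibleRadii hg (hρ u hu).2 (hρ u' hu').2 ha hb hab
    rw [(hρ _ (convex_ball u₀ δ hu hu' ha hb hab)).1] at h1
    exact h1.2
  have hρR : ∀ u, dist u u₀ < δ → |ρ u| ≤ R := fun u hu => by
    rw [abs_of_nonneg (hρ u hu).2.1]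
    exact (lt_of_mem_admissibleRadii hg (hball u hu).1.le hR0.le (hball u hu).2 (hρ u hu).2).le
  -- A bounded concave function is Lipschitz on a smaller ball.
  have hLip := hconc.lipschitzOnWith_of_abs_le (half_pos hδ) hρR
  rw [sub_half] at hLip
  have hhalf : Metric.ball u₀ (δ / 2) ⊆ Metric.ball u₀ δ := Metric.ball_subset_ball (by linarith)
  obtain ⟨p, hp⟩ := (hconc.subset hhalf (convex_ball _ _)).exists_hasRegularUpperDeriv
    (half_pos hδ) hLip h
  have hnhds := Metric.ball_mem_nhds u₀ (half_pos hδ)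
  refine ⟨_, (hp.comp hnhds hLip (hasStrictDerivAt_integral_chiDensity m (ρ u₀))
    (chiDensity_nonneg hm (hρ u₀ (Metric.mem_ball_self hδ)).2.1)).congr ?_⟩
  filter_upwards [hnhds] with u hu
  rw [(hρ u (hhalf hu)).1]
  exact (chiMeasure_real_Icc hm (hρ u (hhalf hu)).2.1).symm

/-- Locally uniform Lipschitz continuity, without any boundedness of the admissible sets. -/
theorem lipschitzOnWith_chiMeasure_admissibleRadii {m : ℕ} (hm : 0 < m)
    (hgc : Continuous fun p : U × E => g p.1 p.2)
    (hg : ConvexOn ℝ Set.univ fun p : U × E => g p.1 p.2) {u₀ : U} {ε : ℝ} (hε : 0 < ε)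
    (h0 : ∀ u ∈ Metric.ball u₀ (2 * ε), g u 0 ≤ 0) (w : E) :
    LipschitzOnWith (m / ε).toNNReal (fun u => (chiMeasure m).real (admissibleRadii g w u))
      (Metric.ball u₀ ε) := by
  have := isProbabilityMeasure_chiMeasure hm
  have key : ∀ u ∈ Metric.ball u₀ ε, ∀ u' ∈ Metric.ball u₀ ε,
      (chiMeasure m).real (admissibleRadii g w u) - (chiMeasure m).real (admissibleRadii g w u') ≤
        m / ε * dist u u' := by
    intro u hu u' hu'
    set d := dist u u' with hd
    have hdn : 0 ≤ d := dist_nonneg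
    rcases hdn.eq_or_lt with hd0 | hd0
    · rw [← hd0, dist_eq_zero.1 (hd.symm.trans hd0.symm)]
      simp
    have hεd : 0 < ε + d := by positivity
    -- Prolonging the segment from `u` past `u'` by length `ε` makes `u'` a convex combination of
    -- `u` and `v`. Radius 0 is admissible at `v`, so radii admissible at `u` remain so at `u'`
    -- after shrinking by `ε / (ε + d)`.
    set v := u' + (ε / d) • (u' - u) with hv
    have hvmem : v ∈ Metric.ball u₀ (2 * ε) := by
      have h1 : dist v u' = ε := by
        rw [hv, dist_eq_norm, add_sub_cancel_left, norm_smul, ← dist_eq_norm, dist_comm u' u, ← hd,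
          Real.norm_of_nonneg (by positivity), div_mul_cancel₀ _ hd0.ne']
      have h2 := dist_triangle v u' u₀
      rw [Metric.mem_ball] at hu' ⊢
      linarith
    have hz : (0 : ℝ) ∈ admissibleRadii g w v := ⟨le_rfl, by simpa using h0 v hvmem⟩
    have hcomb : (ε / (ε + d)) • u + (d / (ε + d)) • v = u' := by
      have h1 : d / (ε + d) * (ε / d) = ε / (ε + d) := by field_simp
      have h2 : u' = (ε / (ε + d) + d / (ε + d)) • u' := by
        rw [← add_div, div_self hεd.ne', one_smul]
      rw [hv, smul_add, smul_smul, h1, smul_sub]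
      conv_rhs => rw [h2, add_smul]
      abel
    have hsub : ∀ r ∈ admissibleRadii g w u, ε / (ε + d) * r ∈ admissibleRadii g w u' := by
      intro r hr
      have h1 := convexComb_mem_admissibleRadii hg hr hz (a := ε / (ε + d)) (b := d / (ε + d))
        (by positivity) (by positivity) (by rw [← add_div, div_self hεd.ne'])
      rwa [hcomb, mul_zero, add_zero] at h1
    have hc0 : 0 < ε / (ε + d) := by positivity
    have hc1 : ε / (ε + d) ≤ 1 := by
      rw [div_le_one hεd]
      linarith
    have h1 := ENNReal.toReal_mono (measure_ne_top _ _) (pow_mul_chiMeasure_le hm hc0 hc1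
      (isClosed_admissibleRadii hgc w u).measurableSet
      (isClosed_admissibleRadii hgc w u').measurableSet hsub)
    rw [ENNReal.toReal_mul, ENNReal.toReal_ofReal (by positivity), ← measureReal_def,
      ← measureReal_def] at h1
    have h2 : 1 - m * (d / (ε + d)) ≤ (ε / (ε + d)) ^ m := by
      have h3 : d / (ε + d) ≤ 1 := by
        rw [div_le_one hεd]
        linarith
      -- Bernoulli's inequality linearizes the loss factor and gives the constant `m / ε`,
      -- independent of `w`.
      have h4 := one_add_mul_le_pow (a := -(d / (ε + d))) (by linarith) m
      have h5 : 1 + -(d / (ε + d)) = ε / (ε + d) := by field_simp; ring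
      rw [h5] at h4
      linarith
    have h6 : d / (ε + d) ≤ d / ε := div_le_div_of_nonneg_left hd0.le hε (by linarith)
    have h7 : (chiMeasure m).real (admissibleRadii g w u) ≤ 1 := measureReal_le_one
    have h8 : 0 ≤ (chiMeasure m).real (admissibleRadii g w u) := measureReal_nonneg
    have h9 : (m : ℝ) * (d / (ε + d)) ≤ m / ε * d := by
      calc (m : ℝ) * (d / (ε + d)) ≤ m * (d / ε) := by gcongr
        _ = m / ε * d := by ring
    have h10 : 0 ≤ (m : ℝ) * (d / (ε + d)) := by positivity
    nlinarith [mul_le_mul_of_nonneg_right h2 h8]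
  refine LipschitzOnWith.of_dist_le_mul fun u hu u' hu' => ?_
  rw [Real.coe_toNNReal _ (by positivity), Real.dist_eq, abs_le]
  have h1 := key u' hu' u hu
  rw [dist_comm] at h1
  constructor <;> linarith [key u hu u' hu']

end Ray

/-! ### The radial probability function and the theorem. -/

theorem LipschitzOnWith.integral {X T : Type*} [PseudoMetricSpace X] [MeasurableSpace T]
    {μ : Measure T} [IsProbabilityMeasure μ] {F : X → T → ℝ} (hF : ∀ u, Integrable (F u) μ)
    {K : NNReal} {N : Set X} (hLip : ∀ t, LipschitzOnWith K (fun u => F u t) N) :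
    LipschitzOnWith K (fun u => ∫ t, F u t ∂μ) N := by
  refine LipschitzOnWith.of_dist_le_mul fun u hu u' hu' => ?_
  rw [dist_eq_norm, ← integral_sub (hF u) (hF u')]
  have := norm_integral_le_of_norm_le_const (μ := μ) (f := fun t => F u t - F u' t)
    (C := K * dist u u') (Eventually.of_forall fun t => by
      rw [← dist_eq_norm]
      exact (hLip t).dist_le_mul u hu u' hu')
  simpa using this

section Radial

variable {U : Type*} {m : ℕ} {A : Matrix (Fin m) (Fin m) ℝ} {g : U → EuclideanSpace ℝ (Fin m) → ℝ}

theorem measurable_radialProbFun (hm : 0 < m) (A : Matrix (Fin m) (Fin m) ℝ) {u : U}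
    (hg : Continuous (g u)) : Measurable (radialProbFun A g u) := by
  have := isProbabilityMeasure_chiMeasure hm
  have h1 : MeasurableSet {q : UnitSphere m × ℝ | 0 ≤ q.2 ∧
      g u (q.2 • Matrix.toEuclideanCLM (𝕜 := ℝ) A (q.1 : EuclideanSpace ℝ (Fin m))) ≤ 0} := by
    have h2 : Continuous fun q : UnitSphere m × ℝ =>
        g u (q.2 • Matrix.toEuclideanCLM (𝕜 := ℝ) A (q.1 : EuclideanSpace ℝ (Fin m))) := by
      fun_prop
    exact ((isClosed_le continuous_const continuous_snd).inter
      (isClosed_le h2 continuous_const)).measurableSet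
  exact (measurable_measure_prodMk_left h1).ennreal_toReal

theorem integrable_radialProbFun (hm : 0 < m) (A : Matrix (Fin m) (Fin m) ℝ) {u : U}
    (hg : Continuous (g u)) : Integrable (radialProbFun A g u) (uniformSphere m) := by
  have := isProbabilityMeasure_chiMeasure hm
  have := isProbabilityMeasure_uniformSphere hm
  refine Integrable.of_bound (measurable_radialProbFun hm A hg).aestronglyMeasurable 1
    (Eventually.of_forall fun v => ?_)
  rw [radialProbFun, Real.norm_of_nonneg measureReal_nonneg]
  exact measureReal_le_one

/-- The spheric-radial decomposition of the probability function. -/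
theorem probFun_eq_integral_radialProbFun {Ω : Type*} [MeasurableSpace Ω] {P : Measure Ω}
    (hm : 0 < m) {ξ : Ω → EuclideanSpace ℝ (Fin m)}
    (hξ : HasLaw ξ (multivariateGaussian 0 (A * A.transpose)) P) {u : U} (hg : Continuous (g u)) :
    probFun P ξ g u = ∫ v, radialProbFun A g u v ∂(uniformSphere m) := by
  have := isProbabilityMeasure_chiMeasure hm
  let L := Matrix.toEuclideanCLM (𝕜 := ℝ) A
  have hB : MeasurableSet {z | g u z ≤ 0} := (isClosed_le hg continuous_const).measurableSet
  have hL : Measurable L := L.continuous.measurable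
  have h1 : P {ω | g u (ξ ω) ≤ 0} = ∫⁻ v, chiMeasure m {r : ℝ | 0 ≤ r ∧
      g u (r • L (v : EuclideanSpace ℝ (Fin m))) ≤ 0} ∂(uniformSphere m) := by
    have h2 := Measure.map_apply_of_aemeasurable hξ.aemeasurable hB
    rw [hξ.map_eq, multivariateGaussian_mul_transpose, Measure.map_apply hL hB,
      stdGaussian_eq_lintegral_chiMeasure hm (hL hB)] at h2
    refine h2.symm.trans (lintegral_congr fun v => ?_)
    simp only [Set.mem_preimage, map_smul]
    rfl
  have h3 : AEMeasurable (fun v : UnitSphere m => chiMeasure m {r : ℝ | 0 ≤ r ∧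
      g u (r • L (v : EuclideanSpace ℝ (Fin m))) ≤ 0}) (uniformSphere m) := by
    have := (measurable_radialProbFun hm A hg).ennreal_ofReal.aemeasurable (μ := uniformSphere m)
    refine this.congr (Eventually.of_forall fun v => ?_)
    exact ENNReal.ofReal_toReal (measure_ne_top _ _)
  rw [probFun, measureReal_def, h1, ← integral_toReal h3
    (Eventually.of_forall fun v => measure_lt_top _ _)]
  rfl

theorem exists_hasRegularUpperDeriv_radialProbFun [NormedAddCommGroup U] [NormedSpace ℝ U]
    (hm : 0 < m) (hgc : Continuous fun p : U × EuclideanSpace ℝ (Fin m) => g p.1 p.2)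
    (hg : ConvexOn ℝ Set.univ fun p : U × EuclideanSpace ℝ (Fin m) => g p.1 p.2)
    {u₀ : U} (h0 : g u₀ 0 < 0)
    (hM : Bornology.IsBounded {z : EuclideanSpace ℝ (Fin m) | g u₀ z ≤ 0}) (v : UnitSphere m)
    (h : U) : ∃ p, HasRegularUpperDeriv (fun u => radialProbFun A g u v) u₀ h p := by
  set w := Matrix.toEuclideanCLM (𝕜 := ℝ) A (v : EuclideanSpace ℝ (Fin m)) with hw
  -- For singular `A` the ray may collapse to the origin, where `g u 0 < 0` persists near `u₀`.
  by_cases hw0 : w = 0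
  · have hcz : Continuous fun u : U => g u 0 := hgc.comp (f := fun u : U => (u, 0)) (by fun_prop)
    refine ⟨0, (HasRegularUpperDeriv.const (radialProbFun A g u₀ v)).congr ?_⟩
    filter_upwards [hcz.continuousAt.eventually (gt_mem_nhds h0)] with u hu
    simp only [radialProbFun, ← hw, hw0, smul_zero, h0.le, hu.le]
  · obtain ⟨C, hC0, hC⟩ := hM.exists_pos_norm_le
    have hwpos : 0 < ‖w‖ := norm_pos_iff.2 hw0
    -- This radius gives a point of norm `C + 1`, outside the bounded set.
    have hR0 : 0 < (C + 1) / ‖w‖ := by positivity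
    refine exists_hasRegularUpperDeriv_chiMeasure_admissibleRadii hm hgc hg h0 (w := w) hR0 ?_ h
    by_contra! hc
    have h1 := hC _ hc
    rw [norm_smul, Real.norm_of_nonneg hR0.le, div_mul_cancel₀ _ hwpos.ne'] at h1
    linarith

end Radial

theorem theorem2p3
    {U : Type*} [NormedAddCommGroup U] [NormedSpace ℝ U] [CompleteSpace U]
    [TopologicalSpace.SeparableSpace U]
    (hrefl : Function.Surjective (NormedSpace.inclusionInDoubleDual ℝ U))
    {Ω : Type*} [MeasurableSpace Ω] (P : Measure Ω) [IsProbabilityMeasure P]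
    (m : ℕ) (hm : 0 < m)
    (Sig A : Matrix (Fin m) (Fin m) ℝ) (hA : A * A.transpose = Sig)
    (ξ : Ω → EuclideanSpace ℝ (Fin m)) (hξ : HasLaw ξ (multivariateGaussian 0 Sig) P)
    (g : U → EuclideanSpace ℝ (Fin m) → ℝ)
    (hgLip : LocallyLipschitz fun p : U × EuclideanSpace ℝ (Fin m) => g p.1 p.2)
    (hgConv : ConvexOn ℝ Set.univ fun p : U × EuclideanSpace ℝ (Fin m) => g p.1 p.2)
    (u₀ : U) (hSlater : g u₀ 0 < 0)
    (hM : Bornology.IsBounded {z : EuclideanSpace ℝ (Fin m) | g u₀ z ≤ 0}) :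
    (∃ K : NNReal, ∃ N ∈ 𝓝 u₀, LipschitzOnWith K (probFun P ξ g) N ∧
      ∀ v : UnitSphere m, LipschitzOnWith K (fun u => radialProbFun A g u v) N) ∧
    clarkeSubdifferential (probFun P ξ g) u₀ =
      aumannIntegral (uniformSphere m)
        (fun v => clarkeSubdifferential (fun u => radialProbFun A g u v) u₀) := by
  subst hA
  have := isProbabilityMeasure_uniformSphere hm
  have hgc := hgLip.continuous
  have hgu : ∀ u, Continuous (g u) := fun u =>
    hgc.comp (f := fun z : EuclideanSpace ℝ (Fin m) => (u, z)) (by fun_prop)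
  have hcz : Continuous fun u : U => g u 0 := hgc.comp (f := fun u : U => (u, 0)) (by fun_prop)
  have hint := fun u => integrable_radialProbFun hm A (hgu u)
  have hφ : probFun P ξ g = fun u => ∫ v, radialProbFun A g u v ∂(uniformSphere m) :=
    funext fun u => probFun_eq_integral_radialProbFun hm hξ (hgu u)
  obtain ⟨δ, hδ, hball⟩ := Metric.eventually_nhds_iff_ball.1
    (hcz.continuousAt.eventually (gt_mem_nhds hSlater))
  -- Half the radius, since the Lipschitz estimate needs `g u 0 ≤ 0` on a ball twice as large.
  have hLip : ∀ v : UnitSphere m, LipschitzOnWith (m / (δ / 2)).toNNReal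
      (fun u => radialProbFun A g u v) (Metric.ball u₀ (δ / 2)) := fun v =>
    lipschitzOnWith_chiMeasure_admissibleRadii hm hgc hgConv (half_pos hδ)
      (fun u hu => (hball u (by rwa [mul_div_cancel₀ _ two_ne_zero] at hu)).le) _
  have hN := Metric.ball_mem_nhds u₀ (half_pos hδ)
  rw [hφ]
  exact ⟨⟨_, _, hN, LipschitzOnWith.integral hint hLip, hLip⟩,
    clarkeSubdifferential_integral_eq_aumannIntegral
      (fun u => (measurable_radialProbFun hm A (hgu u)).stronglyMeasurable) hint hN hLip
      (exists_hasRegularUpperDeriv_radialProbFun hm hgc hgConv hSlater hM)⟩
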